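/- Let $d\ge 0$ and let $A=(a_1,\dots,a_n)$ be a finite configuration of points of $\mathbb{R}^d$, possibly repeated or affinely dependent, whose affine span is $\mathbb{R}^d$. Put $v_i=(a_i,1)\in\mathbb{R}^{d+1}$ and let $Z(V)=\sum_{i=1}^n[0,v_i]$ be the associated zonotope (Minkowski sum). For disjoint $I,B\subseteq[n]$ let $\Pi_{I,B}=\sum_{i\in I}v_i+\sum_{b\in B}[0,v_b]$. The faces of $\Pi_{I,B}$ are the $\Pi_{J,C}$ with $C\subseteq B$ and $I\subseteq J\subseteq I\cup(B\setminus C)$. A fine zonotopal tiling of $Z(V)$ is a set $\mathcal{P}$ of tiles $\Pi_{I,B}$, labelled by pairs $(I,B)$ with $I\cap B=\varnothing$, $|B|=d+1$ and $(a_b)_{b\in B}$ affinely independent, whose union is $Z(V)$ and such that any two of them are disjoint or intersect in a common face $\Pi_{J,C}$ of both. The order of $\Pi_{I,B}$ is $|I|$, and $\mathcal{P}^{(k)}$ is the set of tiles of order $k$. Let $$\mathrm{ch}_k(A)=\bigcap_{S\subseteq[n],\,|S|=n-k}\mathrm{ch}(\{a_i\}_{i\in S}),$$ where $\mathrm{ch}$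 denotes the convex hull. Let $\mathcal{P}$ be any fine zonotopal tiling of $Z(V)$ and let $0\le k\le n-d-1$. Then the simplices $\Delta_B=\mathrm{ch}(\{a_b\}_{b\in B})$, one for each tile $\Pi_{I,B}\in\mathcal{P}^{(k)}$ (counted with multiplicity), cover $\mathrm{ch}_k(A)$ exactly $\binom{k+d}{d}$ times, in the following sense. 1. For Lebesgue-almost every $x\in\mathrm{ch}_k(A)$, exactly $\binom{k+d}{d}$ tiles $\Pi_{I,B}\in\mathcal{P}^{(k)}$ satisfy $x\in\Delta_B$. 2. If $\mathrm{ch}_k(A)$ has nonempty interior, then for every $x\in\mathrm{ch}_k(A)$ at least $\binom{k+d}{d}$ tiles of $\mathcal{P}^{(k)}$ satisfy $x\in\Delta_B$ and at most $\binom{k+d}{d}$ of them have $x$ in the interior of $\Delta_B$; and exactly $\binom{k+d}{d}$ tiles satisfy $x\in\Delta_B$ whenever $x$ lies on the boundary of none of the simplices $\Delta_B$, $\Pi_{I,B}\in\mathcal{P}^{(k)}$. -/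

import Mathlib

open scoped Pointwise

noncomputable section

namespace ZonoTiling

/-- A label `(I, B)`: a pair of sets of indices from `[n]`. -/
abbrev Label (n : ℕ) := Finset (Fin n) × Finset (Fin n)

variable {d n : ℕ}

/-- The projective lift `(x, 1)` of a point `x` of `ℝ^d`, in `ℝ^d × ℝ = ℝ^(d+1)`. -/
def lift (x : EuclideanSpace ℝ (Fin d)) : EuclideanSpace ℝ (Fin d) × ℝ := (x, 1)

/-- The zonotope `Z(V) = ∑ i, [0, v_i]` (a Minkowski sum), where `v_i = (a_i, 1)`. -/
def zonotope (a : Fin n → EuclideanSpace ℝ (Fin d)) : Set (EuclideanSpace ℝ (Fin d) × ℝ) :=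
  ∑ i, segment ℝ 0 (lift (a i))

/-- The parallelepiped `Π_{I,B} = ∑_{i ∈ I} v_i + ∑_{b ∈ B} [0, v_b]` of a label `(I, B)`. -/
def tileSet (a : Fin n → EuclideanSpace ℝ (Fin d)) (T : Label n) :
    Set (EuclideanSpace ℝ (Fin d) × ℝ) :=
  {∑ i ∈ T.1, lift (a i)} + ∑ b ∈ T.2, segment ℝ 0 (lift (a b))

/-- `(I, B)` labels a full-dimensional tile: `I` and `B` are disjoint, `B` has `d + 1` elements,
and the points `a_b`, `b ∈ B`, are affinely independent. -/
structure IsTileLabel (a : Fin n → EuclideanSpace ℝ (Fin d)) (T : Label n) : Prop where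
  disjoint : Disjoint T.1 T.2
  card_eq : T.2.card = d + 1
  affineIndependent : AffineIndependent ℝ (fun b : T.2 => a b)

/-- `Π_{J,C}` is the face of `Π_{I,B}` obtained by fixing the coefficients of the segments
`[0, v_b]`, `b ∈ B \ C`, to `0` or `1`; here `J` is `I` together with the indices whose
coefficient is fixed to `1`. -/
def IsFace (F T : Label n) : Prop :=
  F.2 ⊆ T.2 ∧ T.1 ⊆ F.1 ∧ F.1 ⊆ T.1 ∪ (T.2 \ F.2)

/-- A fine zonotopal tiling of `Z(V)`: a collection of parallelepipeds `Π_{I,B}` that forms a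
polyhedral subdivision of `Z(V)`, i.e. their union is `Z(V)` and any two of them meet in a
(possibly empty) common face `Π_{J,C}`. -/
structure IsFineZonotopalTiling (a : Fin n → EuclideanSpace ℝ (Fin d)) (P : Set (Label n)) :
    Prop where
  isTileLabel : ∀ T ∈ P, IsTileLabel a T
  iUnion_eq : ⋃ T ∈ P, tileSet a T = zonotope a
  inter_face : ∀ T ∈ P, ∀ T' ∈ P, (tileSet a T ∩ tileSet a T').Nonempty →
    ∃ F : Label n, IsFace F T ∧ IsFace F T' ∧
      tileSet a T ∩ tileSet a T' = tileSet a F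

/-- The tiles of order `k`: those `Π_{I,B}` of the tiling for which `I` has `k` elements. -/
def orderTiles (P : Set (Label n)) (k : ℕ) : Set (Label n) := {T ∈ P | T.1.card = k}

/-- The simplex `ch({a_b}_{b ∈ B})` of the tile labelled `(I, B)`. -/
def simplex (a : Fin n → EuclideanSpace ℝ (Fin d)) (T : Label n) :
    Set (EuclideanSpace ℝ (Fin d)) :=
  convexHull ℝ (a '' (T.2 : Set (Fin n)))

/-- `ch_k(A)`: the intersection of the convex hulls of all subconfigurations of size `n - k`. -/
def chk (a : Fin n → EuclideanSpace ℝ (Fin d)) (k : ℕ) : Set (EuclideanSpace ℝ (Fin d)) :=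
  ⋂ S : Finset (Fin n), ⋂ _ : S.card = n - k, convexHull ℝ (a '' (S : Set (Fin n)))

/-- The number of tiles of order `k` whose simplex contains `x`. -/
def coverCount (a : Fin n → EuclideanSpace ℝ (Fin d)) (P : Set (Label n)) (k : ℕ)
    (x : EuclideanSpace ℝ (Fin d)) : ℕ :=
  {T ∈ orderTiles P k | x ∈ simplex a T}.ncard

/-- The number of tiles of order `k` whose simplex contains `x` in its interior. -/
def interiorCoverCount (a : Fin n → EuclideanSpace ℝ (Fin d)) (P : Set (Label n)) (k : ℕ)
    (x : EuclideanSpace ℝ (Fin d)) : ℕ :=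
  {T ∈ orderTiles P k | x ∈ interior (simplex a T)}.ncard

end ZonoTiling

end

/-! Deleting vectors from a fine zonotopal tiling leaves a fine zonotopal tiling of the smaller
zonotope. To see this, regard a tiling as a section of the projection of the cube `[0, 1]ⁿ` onto the
zonotope: along a segment in the direction `v e`, the coordinate `e` of the section grows at most as
fast as the parameter, with equality only if no other coordinate changes, and this makes the
projection of the section along `e` a section again.

Let `x` be a generic point in the convex hull of the `a i`, `i ∈ S`. The tiling restricted to `S`
has exactly one tile which contains `(x, 1) / 2`. As a coefficient `1` is too large at height
`1 / 2`, this means that there is exactly one tile `(I, B)` with `x ∈ Δ_B`, `B ⊆ S` and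
`I ∩ S = ∅`. Let `n = m + d + 1`. Summing over all `S` with `d + 1 + b` elements, the numbers `N i`
of tiles of order `i` with `x ∈ Δ_B` satisfy
`∑ i ≤ m, N i * (m - i).choose b = (m + d + 1).choose (d + 1 + b)` whenever `m - k ≤ b ≤ m`. This
triangular system has the unique solution `N i = (i + d).choose d`, `i ≤ k`. The statements about
all points follow by semicontinuity, as generic points are dense. -/

noncomputable section

namespace ZonoTiling

open Set Filter Topology
open Fintype (linearCombination)

theorem rel_of_finite_closed_cover {α X : Type*} [ConditionallyCompleteLinearOrder X]
    [TopologicalSpace X] [OrderTopology X] [DenselyOrdered X] {R : X → X → Prop} [IsTrans X R]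
    {F : α → Set X} (hF : ∀ i, IsClosed (F i)) (s : Finset α) {a b : X} (hab : a ≤ b)
    (hcover : Icc a b ⊆ ⋃ i ∈ s, F i)
    (hR : ∀ i ∈ s, ∀ x ∈ F i ∩ Icc a b, ∀ y ∈ F i ∩ Icc a b, x ≤ y → R x y) : R a b := by
  classical
  induction s using Finset.strongInduction generalizing a with
  | H s ih =>
    obtain ⟨i, hi, hai⟩ := mem_iUnion₂.1 (hcover (left_mem_Icc.2 hab))
    have ha : a ∈ F i ∩ Icc a b := ⟨hai, left_mem_Icc.2 hab⟩
    obtain ⟨c, hc, hmax⟩ := (isCompact_Icc.inter_left (hF i)).exists_isGreatest ⟨a, ha⟩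
    have hRac : R a c := hR i hi a ha c hc hc.2.1
    rcases hc.2.2.eq_or_lt with rfl | hlt
    · exact hRac
    have hcover' : Icc c b ⊆ ⋃ j ∈ s.erase i, F j := by
      rw [← closure_Ioc hlt.ne]
      refine closure_minimal (fun x hx => ?_)
        ((s.erase i).finite_toSet.isClosed_biUnion fun j _ => hF j)
      have hx' : x ∈ Icc a b := ⟨hc.2.1.trans hx.1.le, hx.2⟩
      obtain ⟨j, hj, hxj⟩ := mem_iUnion₂.1 (hcover hx')
      have hji : j ≠ i := by
        rintro rfl
        exact (hmax ⟨hxj, hx'⟩).not_gt hx.1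
      exact mem_iUnion₂.2 ⟨j, Finset.mem_erase.2 ⟨hji, hj⟩, hxj⟩
    have hRcb : R c b := ih (s.erase i) (Finset.erase_ssubset hi) hlt.le hcover'
      fun j hj x hx y hy => hR j (Finset.mem_of_mem_erase hj)
        x ⟨hx.1, Icc_subset_Icc_left hc.2.1 hx.2⟩ y ⟨hy.1, Icc_subset_Icc_left hc.2.1 hy.2⟩
    exact _root_.trans hRac hRcb

theorem continuousOn_invFunOn_image {X Y : Type*} [TopologicalSpace X] [Nonempty X]
    [TopologicalSpace Y] [T2Space Y] {f : X → Y} {K : Set X} (hK : IsCompact K)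
    (hf : ContinuousOn f K) (hinj : InjOn f K) : ContinuousOn (Function.invFunOn f K) (f '' K) := by
  refine continuousOn_iff_isClosed.2 fun t ht => ⟨f '' (K ∩ t), ?_, ?_⟩
  · exact ((hK.inter_right ht).image_of_continuousOn (hf.mono inter_subset_left)).isClosed
  · ext y
    constructor
    · rintro ⟨hyt, x, hx, rfl⟩
      rw [mem_preimage, hinj.leftInvOn_invFunOn hx] at hyt
      exact ⟨⟨x, ⟨hx, hyt⟩, rfl⟩, x, hx, rfl⟩
    · rintro ⟨⟨x, ⟨hx, hxt⟩, rfl⟩, hy⟩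
      exact ⟨by rwa [mem_preimage, hinj.leftInvOn_invFunOn hx], hy⟩

theorem eventually_mem_imp_mem {α X : Type*} [Finite α] [TopologicalSpace X] {F : α → Set X}
    (hF : ∀ i, IsClosed (F i)) (x : X) : ∀ᶠ y in 𝓝 x, ∀ i, y ∈ F i → x ∈ F i := by
  refine eventually_all.2 fun i => ?_
  by_cases hx : x ∈ F i
  · exact Eventually.of_forall fun _ _ => hx
  · exact ((hF i).isOpen_compl.eventually_mem hx).mono fun _ hy hy' => absurd hy' hy

theorem eventually_mem_of_mem_interior {α X : Type*} [Finite α] [TopologicalSpace X]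
    (F : α → Set X) (x : X) : ∀ᶠ y in 𝓝 x, ∀ i, x ∈ interior (F i) → y ∈ F i :=
  eventually_all.2 fun _ => eventually_imp_distrib_left.2 mem_interior_iff_mem_nhds.1

section Box

variable {ι : Type*}

/-- The face of the cube `[0, 1] ^ ι` with label `(I, B)`: the coordinates in `I` are equal to `1`,
those in `B` are free, and the remaining ones are equal to `0`. A linear map which sends the basis
vectors to the `v i` sends this face to the parallelepiped with label `(I, B)`. -/
def box (T : Finset ι × Finset ι) : Set (ι → ℝ) :=
  Icc ((T.1 : Set ι).indicator 1) ((T.1 ∪ T.2 : Set ι).indicator 1)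

theorem mem_box_iff {T : Finset ι × Finset ι} {l : ι → ℝ} :
    l ∈ box T ↔ (∀ i, l i ∈ Icc (0 : ℝ) 1) ∧ (∀ i ∈ T.1, l i = 1) ∧
      ∀ i, i ∉ T.1 → i ∉ T.2 → l i = 0 := by
  classical
  simp only [box, mem_Icc, Pi.le_def, indicator_apply, ← forall_and, Pi.one_apply, mem_union,
    Finset.mem_coe]
  refine forall_congr' fun i => ?_
  grind

theorem box_empty_fst (B : Finset ι) : box (∅, B) = Icc 0 ((B : Set ι).indicator 1) := by
  rw [box, Finset.coe_empty, indicator_empty', empty_union]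

theorem mem_box_empty_iff {B : Finset ι} {l : ι → ℝ} :
    l ∈ box (∅, B) ↔ (∀ i, l i ∈ Icc (0 : ℝ) 1) ∧ ∀ i ∉ B, l i = 0 := by
  simp [mem_box_iff]

theorem coord_mem_Icc {T : Finset ι × Finset ι} {l : ι → ℝ} (hl : l ∈ box T) (i : ι) :
    l i ∈ Icc (0 : ℝ) 1 :=
  (mem_box_iff.1 hl).1 i

theorem box_subset_box {F T : Finset ι × Finset ι} (h₁ : T.1 ⊆ F.1)
    (h₂ : (F.1 ∪ F.2 : Set ι) ⊆ T.1 ∪ T.2) : box F ⊆ box T :=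
  Icc_subset_Icc (indicator_le_indicator_of_subset h₁ fun _ => zero_le_one)
    (indicator_le_indicator_of_subset h₂ fun _ => zero_le_one)

theorem coord_eq_of_notMem {T : Finset ι × Finset ι} {l m : ι → ℝ} (hl : l ∈ box T)
    (hm : m ∈ box T) {i : ι} (hi : i ∉ T.2) : l i = m i := by
  rw [mem_box_iff] at hl hm
  by_cases h : i ∈ T.1
  · rw [hl.2.1 i h, hm.2.1 i h]
  · rw [hl.2.2 i h hi, hm.2.2 i h hi]

/-- The center of the face `box T`, for disjoint `T.1` and `T.2`. -/
def boxCenter (T : Finset ι × Finset ι) : ι → ℝ :=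
  (T.1 : Set ι).indicator 1 + (T.2 : Set ι).indicator fun _ => 1 / 2

theorem boxCenter_add_mem_box {T : Finset ι × Finset ι} (hT : Disjoint T.1 T.2) {c : ι → ℝ}
    (hc : ∀ i ∉ T.2, c i = 0) (hc_le : ∀ i, |c i| ≤ 1 / 2) : boxCenter T + c ∈ box T := by
  refine mem_box_iff.2 ⟨fun i => ?_, fun i hi => ?_, fun i hi₁ hi₂ => ?_⟩
  · obtain ⟨hl, hu⟩ := abs_le.1 (hc_le i)
    by_cases hi₂ : i ∈ T.2
    · have hi₁ : i ∉ T.1 := Finset.disjoint_right.1 hT hi₂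
      simp only [boxCenter, Pi.add_apply, Finset.mem_coe, hi₁, hi₂, not_false_eq_true,
        indicator_of_notMem, indicator_of_mem, mem_Icc]
      constructor <;> linarith
    · by_cases hi₁ : i ∈ T.1 <;> simp [boxCenter, hi₁, hi₂, hc]
  · have hi₂ : i ∉ T.2 := Finset.disjoint_left.1 hT hi
    simp [boxCenter, hi, hi₂, hc]
  · simp [boxCenter, hi₁, hi₂, hc]

theorem boxCenter_mem_box {T : Finset ι × Finset ι} (hT : Disjoint T.1 T.2) :
    boxCenter T ∈ box T := by
  simpa using boxCenter_add_mem_box hT (c := 0)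

theorem boxCenter_insert [DecidableEq ι] {e : ι} {I : Finset ι} (heI : e ∉ I) (B : Finset ι) :
    boxCenter (insert e I, B) = boxCenter (I, B) + Pi.single e 1 := by
  ext i
  obtain rfl | hie := eq_or_ne i e
  · simp [boxCenter, heI, add_comm]
  · simp [boxCenter, hie, indicator_apply]

/-- The union of the faces of the cube `[0, 1] ^ ι` labelled by `Q`. -/
def boxUnion (Q : Set (Finset ι × Finset ι)) : Set (ι → ℝ) := ⋃ T ∈ Q, box T

theorem subset_boxUnion {Q : Set (Finset ι × Finset ι)} {T : Finset ι × Finset ι} (hT : T ∈ Q) :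
    box T ⊆ boxUnion Q :=
  subset_biUnion_of_mem hT

theorem isCompact_boxUnion [Finite ι] (Q : Set (Finset ι × Finset ι)) : IsCompact (boxUnion Q) :=
  Q.toFinite.isCompact_biUnion fun _ _ => isCompact_Icc

theorem add_single_mem_box [DecidableEq ι] {S : Finset ι} {e : ι} (he : e ∈ S) {l : ι → ℝ}
    (hl : l ∈ box (∅, S.erase e)) {t : ℝ} (ht : t ∈ Icc (0 : ℝ) 1) :
    l + Pi.single e t ∈ box (∅, S) := by
  rw [mem_box_empty_iff] at hl ⊢
  have hle : l e = 0 := hl.2 e (Finset.notMem_erase e S)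
  refine ⟨fun i => ?_, fun i hi => ?_⟩
  · obtain rfl | hie := eq_or_ne i e
    · simpa [hle] using ht
    · simpa [hie] using hl.1 i
  · have hie : i ≠ e := ne_of_mem_of_not_mem he hi |>.symm
    simp [hie, hl.2 i (mt Finset.mem_of_mem_erase hi)]

/-- The label obtained by deleting the indices outside `R`. -/
def restrictLabel [DecidableEq ι] (R : Finset ι) (T : Finset ι × Finset ι) :
    Finset ι × Finset ι :=
  (T.1 ∩ R, T.2 ∩ R)

theorem image_indicator_box [DecidableEq ι] (R : Finset ι) (T : Finset ι × Finset ι) :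
    (R : Set ι).indicator '' box T = box (restrictLabel R T) := by
  ext l
  simp only [mem_image, mem_box_iff, restrictLabel, Finset.mem_inter]
  constructor
  · rintro ⟨m, hm, rfl⟩
    grind [indicator_apply]
  · intro hl
    refine ⟨fun i => if i ∈ R then l i else if i ∈ T.1 then 1 else 0, ⟨?_, ?_, ?_⟩, ?_⟩
    all_goals grind [indicator_apply]

theorem boxUnion_restrictLabel [DecidableEq ι] (R : Finset ι) (Q : Set (Finset ι × Finset ι)) :
    boxUnion (restrictLabel R '' Q) = (R : Set ι).indicator '' boxUnion Q := by
  simp only [boxUnion, biUnion_image, image_iUnion₂, image_indicator_box]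

theorem restrictLabel_restrictLabel [DecidableEq ι] {R S : Finset ι} (hRS : R ⊆ S)
    (T : Finset ι × Finset ι) : restrictLabel R (restrictLabel S T) = restrictLabel R T := by
  simp only [restrictLabel, Finset.inter_assoc, Finset.inter_eq_right.2 hRS]

end Box

section LinearCombination

variable {ι E : Type*} [Fintype ι] [AddCommGroup E] [Module ℝ E] {v : ι → E}

theorem linearCombination_indicator (v : ι → E) (B : Finset ι) (l : ι → ℝ) :
    linearCombination ℝ v ((B : Set ι).indicator l) = ∑ i ∈ B, l i • v i := by
  rw [Fintype.linearCombination_apply,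
    ← Finset.sum_subset (Finset.subset_univ B) fun i _ hi => by simp [hi]]
  exact Finset.sum_congr rfl fun i hi => by simp [hi]

theorem eq_of_linearCombination_eq {B : Finset ι} (hB : LinearIndepOn ℝ v (B : Set ι))
    {l m : ι → ℝ} (heq : ∀ i ∉ B, l i = m i)
    (h : linearCombination ℝ v l = linearCombination ℝ v m) : l = m := by
  have hsum : ∑ i ∈ B, (l - m) i • v i = 0 := by
    have hind : (B : Set ι).indicator (l - m) = l - m :=
      indicator_eq_self.2 fun i => not_imp_comm.1 fun hi => by simp [heq i hi]
    rw [← linearCombination_indicator, hind, map_sub, h, sub_self]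
  ext i
  by_cases hi : i ∈ B
  · exact sub_eq_zero.1 (linearIndepOn_finset_iff.1 hB _ hsum i hi)
  · exact heq i hi

theorem injOn_linearCombination_box {T : Finset ι × Finset ι}
    (hB : LinearIndepOn ℝ v (T.2 : Set ι)) : InjOn (linearCombination ℝ v) (box T) :=
  fun _ hl _ hm => eq_of_linearCombination_eq hB fun _ => coord_eq_of_notMem hl hm

theorem exists_linearCombination_eq_of_mem_span {B : Finset ι} {x : E}
    (hx : x ∈ Submodule.span ℝ (v '' B)) :
    ∃ c : ι → ℝ, (∀ i ∉ B, c i = 0) ∧ linearCombination ℝ v c = x := by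
  obtain ⟨c, hc, rfl⟩ := (Finsupp.mem_span_image_iff_linearCombination ℝ).1 hx
  refine ⟨c, (Finsupp.mem_supported' ℝ c).1 hc, ?_⟩
  rw [← Finsupp.linearCombination_eq_fintype_linearCombination_apply,
    Finsupp.linearEquivFunOnFinite_symm_coe]

theorem linearCombination_indicator_erase [DecidableEq ι] {S : Finset ι} {l : ι → ℝ}
    (hl : ∀ i ∉ S, l i = 0) (e : ι) :
    linearCombination ℝ v ((S.erase e : Set ι).indicator l) =
      linearCombination ℝ v l - l e • v e := by
  rw [← Fintype.linearCombination_apply_single, ← map_sub]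
  congr 1
  ext i
  obtain rfl | hie := eq_or_ne i e
  · simp
  · by_cases hi : i ∈ S <;> simp [hie, hi, hl]

theorem eq_add_single_or_lt_of_mem_box [DecidableEq ι] {T : Finset ι × Finset ι}
    (hT : LinearIndepOn ℝ v (T.2 : Set ι)) {e : ι} {l m : ι → ℝ} (hl : l ∈ box T) (hm : m ∈ box T)
    {t : ℝ} (ht : 0 ≤ t)
    (hlm : linearCombination ℝ v m = linearCombination ℝ v l + t • v e) :
    m = l + Pi.single e t ∨ m e < l e + t := by
  by_cases he : e ∈ T.2
  · refine .inl (eq_of_linearCombination_eq hT (fun i hi => ?_) ?_)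
    · have hie : i ≠ e := (ne_of_mem_of_not_mem he hi).symm
      simp [hie, coord_eq_of_notMem hm hl hi]
    · rw [hlm, map_add, Fintype.linearCombination_apply_single]
  obtain rfl | ht := ht.eq_or_lt
  · exact .inl (by simpa using injOn_linearCombination_box hT hm hl (by simpa using hlm))
  · exact .inr (by linarith [coord_eq_of_notMem hl hm he])

theorem image_box_empty_fst (v : ι → E) (B : Finset ι) :
    linearCombination ℝ v '' box (∅, B) = ∑ b ∈ B, segment ℝ 0 (v b) := by
  classical
  have hbox : box (∅, B) = (B : Set ι).indicator '' Icc (0 : ι → ℝ) 1 := by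
    have h := image_indicator_box B (∅, Finset.univ)
    simp only [restrictLabel, Finset.empty_inter, Finset.univ_inter] at h
    rw [← h, box_empty_fst, Finset.coe_univ, indicator_univ]
  have hcomp (l : ι → ℝ) : linearCombination ℝ v ((B : Set ι).indicator l) =
      ∑ i, l i • (B : Set ι).indicator v i :=
    Finset.sum_congr rfl fun i _ => by by_cases hi : i ∈ B <;> simp [hi]
  calc linearCombination ℝ v '' box (∅, B)
      = parallelepiped ((B : Set ι).indicator v) := by
        rw [hbox, image_image, parallelepiped]
        exact image_congr fun l _ => hcomp l
    _ = ∑ i, segment ℝ 0 ((B : Set ι).indicator v i) := parallelepiped_eq_sum_segment _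
    _ = ∑ b ∈ B, segment ℝ 0 ((B : Set ι).indicator v b) :=
        (Finset.sum_subset (Finset.subset_univ B) fun i _ hi => by simp [hi, singleton_zero]).symm
    _ = ∑ b ∈ B, segment ℝ 0 (v b) := Finset.sum_congr rfl fun b hb => by simp [hb]

theorem image_box {T : Finset ι × Finset ι} (hT : Disjoint T.1 T.2) :
    linearCombination ℝ v '' box T =
      {∑ i ∈ T.1, v i} + ∑ b ∈ T.2, segment ℝ 0 (v b) := by
  have hbox : box T = ((T.1 : Set ι).indicator 1 + ·) '' box (∅, T.2) := by
    rw [box_empty_fst, image_const_add_Icc, add_zero, box,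
      indicator_union_of_disjoint (Finset.disjoint_coe.2 hT)]
    rfl
  have hsum : linearCombination ℝ v ((T.1 : Set ι).indicator 1) = ∑ i ∈ T.1, v i := by
    simp [linearCombination_indicator]
  rw [← image_box_empty_fst, hbox, singleton_add, ← hsum, image_image, image_image]
  simp only [map_add]

end LinearCombination

section TilingSection

variable {ι E : Type*} [Fintype ι] [AddCommGroup E] [Module ℝ E]

/-- The parallelepipeds labelled by `Q` tile the zonotope of `(v i)_{i ∈ S}`, in the form: the
projection of the cube `[0, 1] ^ S` onto this zonotope has a section, whose image is the union of
the faces of the cube labelled by `Q`. In contrast to a condition on the pairwise intersections of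
the tiles, this passes easily to subconfigurations. -/
structure IsTilingSection (v : ι → E) (S : Finset ι) (Q : Set (Finset ι × Finset ι)) : Prop where
  disjoint : ∀ T ∈ Q, Disjoint T.1 T.2
  linearIndepOn : ∀ T ∈ Q, LinearIndepOn ℝ v (T.2 : Set ι)
  subset : ∀ T ∈ Q, T.1 ⊆ S ∧ T.2 ⊆ S
  injOn : InjOn (linearCombination ℝ v) (boxUnion Q)
  surjOn : SurjOn (linearCombination ℝ v) (boxUnion Q) (linearCombination ℝ v '' box (∅, S))

/-- The section itself: the coefficients in the union of the faces labelled by `Q` which represent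
a point. -/
def coords (v : ι → E) (Q : Set (Finset ι × Finset ι)) : E → ι → ℝ :=
  Function.invFunOn (linearCombination ℝ v) (boxUnion Q)

namespace IsTilingSection

variable {v : ι → E} {S : Finset ι} {Q : Set (Finset ι × Finset ι)}

theorem boxUnion_subset (h : IsTilingSection v S Q) : boxUnion Q ⊆ box (∅, S) :=
  iUnion₂_subset fun T hT => box_subset_box (Finset.empty_subset _)
    ((union_subset (Finset.coe_subset.2 (h.subset T hT).1)
      (Finset.coe_subset.2 (h.subset T hT).2)).trans subset_union_right)

theorem coords_linearCombination (h : IsTilingSection v S Q) {l : ι → ℝ} (hl : l ∈ boxUnion Q) :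
    coords v Q (linearCombination ℝ v l) = l :=
  h.injOn.leftInvOn_invFunOn hl

theorem coords_mem (h : IsTilingSection v S Q) {p : E}
    (hp : p ∈ linearCombination ℝ v '' box (∅, S)) : coords v Q p ∈ boxUnion Q :=
  Function.invFunOn_mem (h.surjOn hp)

theorem linearCombination_coords (h : IsTilingSection v S Q) {p : E}
    (hp : p ∈ linearCombination ℝ v '' box (∅, S)) : linearCombination ℝ v (coords v Q p) = p :=
  Function.invFunOn_eq (h.surjOn hp)

theorem coords_mem_box (h : IsTilingSection v S Q) {T : Finset ι × Finset ι} (hT : T ∈ Q) {p : E}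
    (hp : p ∈ linearCombination ℝ v '' box T) : coords v Q p ∈ box T := by
  obtain ⟨l, hl, rfl⟩ := hp
  rwa [h.coords_linearCombination (subset_boxUnion hT hl)]

variable [TopologicalSpace E] [IsTopologicalAddGroup E] [ContinuousSMul ℝ E] [T2Space E]

theorem continuousOn_coords (h : IsTilingSection v S Q) :
    ContinuousOn (coords v Q) (linearCombination ℝ v '' box (∅, S)) :=
  (continuousOn_invFunOn_image (isCompact_boxUnion Q)
    (LinearMap.continuous_on_pi _).continuousOn h.injOn).mono h.surjOn

theorem eq_add_single_or_lt [DecidableEq ι] (h : IsTilingSection v S Q) {e : ι} {l m : ι → ℝ}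
    (hl : l ∈ boxUnion Q) (hm : m ∈ boxUnion Q) {t : ℝ} (ht : 0 ≤ t)
    (hlm : linearCombination ℝ v m = linearCombination ℝ v l + t • v e) :
    m = l + Pi.single e t ∨ m e < l e + t := by
  let p : ℝ → E := AffineMap.lineMap (linearCombination ℝ v l) (linearCombination ℝ v m)
  let γ : ℝ → ι → ℝ := fun u => coords v Q (p u)
  let R : ℝ → ℝ → Prop := fun u w =>
    γ w = γ u + Pi.single e ((w - u) * t) ∨ γ w e < γ u e + (w - u) * t
  have hp : ∀ u ∈ Icc (0 : ℝ) 1, p u ∈ linearCombination ℝ v '' box (∅, S) := fun u hu =>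
    ((convex_Icc _ _).linear_image _).lineMap_mem (mem_image_of_mem _ (h.boxUnion_subset hl))
      (mem_image_of_mem _ (h.boxUnion_subset hm)) hu
  have hp_add (u w : ℝ) : p w = p u + ((w - u) * t) • v e := by
    simp only [p, AffineMap.lineMap_apply_module', hlm]
    module
  have hR_trans : IsTrans ℝ R := by
    refine ⟨fun x y z hxy hyz => ?_⟩
    have hle {u w} (huw : R u w) : γ w e ≤ γ u e + (w - u) * t :=
      huw.elim (fun heq => by simp [heq]) le_of_lt
    rcases hxy with hxy_eq | hxy_lt
    · rcases hyz with hyz_eq | hyz_lt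
      · left
        rw [hyz_eq, hxy_eq, add_assoc, ← Pi.single_add]
        ring_nf
      · exact .inr (by linarith [hle (.inl hxy_eq)])
    · exact .inr (by linarith [hle hyz])
  have hR : R 0 1 := by
    refine rel_of_finite_closed_cover (F := fun T => p ⁻¹' (linearCombination ℝ v '' box T))
      (fun T => ?_) Q.toFinite.toFinset zero_le_one (fun u hu => ?_) ?_
    · exact (isCompact_Icc.image (LinearMap.continuous_on_pi _)).isClosed.preimage
        AffineMap.lineMap_continuous
    · obtain ⟨T, hT, hγ⟩ := mem_iUnion₂.1 (h.coords_mem (hp u hu))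
      exact mem_iUnion₂.2 ⟨T, by simpa using hT, γ u, hγ, h.linearCombination_coords (hp u hu)⟩
    · intro T hT u hu w hw huw
      replace hT : T ∈ Q := by simpa using hT
      refine eq_add_single_or_lt_of_mem_box (h.linearIndepOn T hT) (h.coords_mem_box hT hu.1)
        (h.coords_mem_box hT hw.1) (mul_nonneg (sub_nonneg.2 huw) ht) ?_
      rw [h.linearCombination_coords (hp u hu.2), h.linearCombination_coords (hp w hw.2)]
      exact hp_add u w
  simpa [R, γ, p, h.coords_linearCombination hl, h.coords_linearCombination hm] using hR

theorem exists_linearCombination_eq_add [DecidableEq ι] (h : IsTilingSection v S Q) {e : ι}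
    (he : e ∈ S) {m : ι → ℝ} (hm : m ∈ box (∅, S.erase e)) :
    ∃ l ∈ boxUnion Q, linearCombination ℝ v l = linearCombination ℝ v m + l e • v e := by
  let p : ℝ → E := fun t => linearCombination ℝ v m + t • v e
  have hp : MapsTo p (Icc 0 1) (linearCombination ℝ v '' box (∅, S)) := fun t ht =>
    ⟨m + Pi.single e t, add_single_mem_box he hm ht, by
      rw [map_add, Fintype.linearCombination_apply_single]⟩
  have hcont : ContinuousOn (fun t => coords v Q (p t) e) (Icc 0 1) :=
    (continuous_apply e).comp_continuousOn (h.continuousOn_coords.comp (by fun_prop) hp)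
  obtain ⟨t, ht, hfix⟩ := exists_mem_Icc_isFixedPt_of_mapsTo hcont zero_le_one fun t ht =>
    coord_mem_Icc (h.boxUnion_subset (h.coords_mem (hp ht))) e
  refine ⟨coords v Q (p t), h.coords_mem (hp ht), ?_⟩
  rw [h.linearCombination_coords (hp ht), show coords v Q (p t) e = t from hfix]

theorem erase [DecidableEq ι] (h : IsTilingSection v S Q) {e : ι} (he : e ∈ S) :
    IsTilingSection v (S.erase e) (restrictLabel (S.erase e) '' Q) where
  disjoint := forall_mem_image.2 fun T hT =>
    (h.disjoint T hT).mono Finset.inter_subset_left Finset.inter_subset_left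
  linearIndepOn := forall_mem_image.2 fun T hT =>
    (h.linearIndepOn T hT).mono (Finset.coe_subset.2 Finset.inter_subset_left)
  subset := forall_mem_image.2 fun _ _ => ⟨Finset.inter_subset_right, Finset.inter_subset_right⟩
  injOn := by
    rw [boxUnion_restrictLabel]
    rintro _ ⟨l, hl, rfl⟩ _ ⟨m, hm, rfl⟩ hlm
    rw [linearCombination_indicator_erase (mem_box_empty_iff.1 (h.boxUnion_subset hl)).2,
      linearCombination_indicator_erase (mem_box_empty_iff.1 (h.boxUnion_subset hm)).2] at hlm
    wlog hle : l e ≤ m e generalizing l m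
    · exact (this m hm l hl hlm.symm (le_of_not_ge hle)).symm
    have hadd : linearCombination ℝ v m = linearCombination ℝ v l + (m e - l e) • v e := by
      rw [sub_smul, ← add_sub_assoc, add_sub_right_comm, hlm, sub_add_cancel]
    obtain heq | hlt := h.eq_add_single_or_lt hl hm (sub_nonneg.2 hle) hadd
    · rw [heq]
      exact indicator_congr fun i hi => by simp [Finset.ne_of_mem_erase hi]
    · linarith
  surjOn := by
    rintro _ ⟨m, hm, rfl⟩
    obtain ⟨l, hl, hlm⟩ := h.exists_linearCombination_eq_add he hm
    rw [boxUnion_restrictLabel]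
    refine ⟨_, mem_image_of_mem _ hl, ?_⟩
    rw [linearCombination_indicator_erase (mem_box_empty_iff.1 (h.boxUnion_subset hl)).2, hlm,
      add_sub_cancel_right]

theorem restrict [DecidableEq ι] {R : Finset ι} (h : IsTilingSection v S Q) (hRS : R ⊆ S) :
    IsTilingSection v R (restrictLabel R '' Q) := by
  induction S using Finset.strongInduction generalizing Q with
  | H S ih =>
    obtain rfl | hne := eq_or_ne R S
    · have hid : ∀ T ∈ Q, restrictLabel R T = T := fun T hT =>
        Prod.ext (Finset.inter_eq_left.2 (h.subset T hT).1)
          (Finset.inter_eq_left.2 (h.subset T hT).2)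
      rwa [image_congr hid, image_id']
    · obtain ⟨e, heS, heR⟩ := Finset.exists_of_ssubset (hRS.ssubset_of_ne hne)
      have hR : R ⊆ S.erase e := Finset.subset_erase.2 ⟨hRS, heR⟩
      simpa only [image_image, restrictLabel_restrictLabel hR] using
        ih _ (Finset.erase_ssubset heS) (h.erase heS) hR

theorem insert_notMem [DecidableEq ι] (h : IsTilingSection v S Q) {e : ι} {I B : Finset ι}
    (heI : e ∉ I) (heB : e ∉ B) (hspan : v e ∈ Submodule.span ℝ (v '' (B : Set ι)))
    (hT : (I, B) ∈ Q) :
    (insert e I, B) ∉ Q := by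
  intro hT'
  obtain ⟨c, hcB, hc⟩ := exists_linearCombination_eq_of_mem_span hspan
  obtain ⟨s, hs, hsc⟩ := exists_pos_mul_lt one_half_pos (‖c‖ + 1)
  have hs_lt : s < 1 := by nlinarith [norm_nonneg c]
  have hsc_le (i : ι) : |(s • c) i| ≤ 1 / 2 := by
    have hle : ‖(s • c) i‖ ≤ s * ‖c‖ := norm_smul_of_nonneg hs.le c ▸ norm_le_pi_norm (s • c) i
    rw [Real.norm_eq_abs] at hle
    linarith
  have hl : boxCenter (I, B) + s • c ∈ box (I, B) :=
    boxCenter_add_mem_box (h.disjoint _ hT) (fun i hi => by simp [hcB i hi]) hsc_le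
  have hm : boxCenter (I, B) + Pi.single e 1 ∈ box (insert e I, B) :=
    boxCenter_insert heI B ▸ boxCenter_mem_box (h.disjoint _ hT')
  have hlm : linearCombination ℝ v (boxCenter (I, B) + Pi.single e 1) =
      linearCombination ℝ v (boxCenter (I, B) + s • c) + (1 - s) • v e := by
    rw [map_add, map_add, map_smul, hc, Fintype.linearCombination_apply_single]
    module
  have hc_zero : (boxCenter (I, B) + s • c) e = boxCenter (I, B) e := by simp [hcB e heB]
  obtain heq | hlt := h.eq_add_single_or_lt (subset_boxUnion hT hl) (subset_boxUnion hT' hm)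
    (by linarith) hlm
  · have hcoord := congrFun heq e
    simp only [Pi.add_apply, Pi.single_eq_same] at hcoord hc_zero
    linarith
  · simp only [Pi.add_apply, Pi.single_eq_same] at hlt hc_zero
    linarith

theorem fst_eq (h : IsTilingSection v S Q) {I I' B : Finset ι}
    (hspan : v '' S ⊆ Submodule.span ℝ (v '' (B : Set ι))) (hI : (I, B) ∈ Q) (hI' : (I', B) ∈ Q) :
    I = I' := by
  classical
  suffices hsub : ∀ {I I'}, (I, B) ∈ Q → (I', B) ∈ Q → I ⊆ I' from
    (hsub hI hI').antisymm (hsub hI' hI)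
  intro I I' hI hI' e heI
  by_contra heI'
  have heB : e ∉ B := Finset.disjoint_left.1 (h.disjoint _ hI) heI
  have heS : e ∈ S := (h.subset _ hI).1 heI
  have hrestrict := h.restrict (Finset.insert_subset heS (h.subset _ hI).2)
  have hlabel {J : Finset ι} (hJ : (J, B) ∈ Q) :
      (J ∩ insert e B, B) ∈ restrictLabel (insert e B) '' Q :=
    ⟨_, hJ, Prod.ext rfl (Finset.inter_eq_left.2 (Finset.subset_insert e B))⟩
  refine hrestrict.insert_notMem (fun he => heI' (Finset.mem_of_mem_inter_left he)) heB
    (hspan ⟨e, heS, rfl⟩) (hlabel hI') ?_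
  convert hlabel hI using 2
  have := h.disjoint _ hI
  have := h.disjoint _ hI'
  grind [Finset.disjoint_left]

end IsTilingSection

end TilingSection

section Tiling

variable {d n : ℕ} {a : Fin n → EuclideanSpace ℝ (Fin d)} {P : Set (Label n)}

theorem linearCombination_lift (a : Fin n → EuclideanSpace ℝ (Fin d)) (l : Fin n → ℝ) :
    linearCombination ℝ (lift ∘ a) l = (∑ i, l i • a i, ∑ i, l i) := by
  rw [Fintype.linearCombination_apply]
  ext1 <;> simp [lift, Prod.fst_sum, Prod.snd_sum]

theorem linearIndepOn_lift {B : Finset (Fin n)} (hB : AffineIndependent ℝ fun b : B => a b) :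
    LinearIndepOn ℝ (lift ∘ a) (B : Set (Fin n)) := by
  rw [affineIndependent_iff] at hB
  refine linearIndepOn_finset_iff.2 fun c hc i hi => ?_
  have hpoint : ∑ b : B, c b • a b = 0 := by
    rw [Finset.sum_coe_sort B fun b => c b • a b]
    simpa [lift, Prod.fst_sum] using congrArg Prod.fst hc
  have hweight : ∑ b : B, c b = 0 := by
    rw [Finset.sum_coe_sort B c]
    simpa [lift, Prod.snd_sum] using congrArg Prod.snd hc
  exact hB Finset.univ (fun b => c b) hweight hpoint ⟨i, hi⟩ (Finset.mem_univ _)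

theorem span_lift_eq_top {T : Label n} (hT : IsTileLabel a T) :
    Submodule.span ℝ ((lift ∘ a) '' (T.2 : Set (Fin n))) = ⊤ := by
  have hcard : Fintype.card (T.2 : Set (Fin n)) =
      Module.finrank ℝ (EuclideanSpace ℝ (Fin d) × ℝ) := by
    simp [hT.card_eq]
  rw [image_eq_range]
  exact LinearIndependent.span_eq_top_of_card_eq_finrank'
    (linearIndepOn_lift hT.affineIndependent) hcard

theorem tileSet_eq_image_box {T : Label n} (hT : Disjoint T.1 T.2) :
    tileSet a T = linearCombination ℝ (lift ∘ a) '' box T :=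
  (image_box hT).symm

theorem zonotope_eq_image_box :
    zonotope a = linearCombination ℝ (lift ∘ a) '' box (∅, Finset.univ) :=
  (image_box_empty_fst _ _).symm

namespace IsFace

variable {F T : Label n}

theorem box_subset (h : IsFace F T) : box F ⊆ box T := by
  refine box_subset_box h.2.1 ?_
  norm_cast
  exact Finset.union_subset (h.2.2.trans (Finset.union_subset_union_right Finset.sdiff_subset))
    (h.1.trans Finset.subset_union_right)

theorem disjoint (h : IsFace F T) (hT : Disjoint T.1 T.2) : Disjoint F.1 F.2 :=
  (Finset.disjoint_union_left.2 ⟨hT.mono_right h.1, Finset.sdiff_disjoint⟩).mono_left h.2.2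

end IsFace

theorem mem_convexHull_image_iff {C : Finset (Fin n)} {x : EuclideanSpace ℝ (Fin d)} {t : ℝ}
    (ht₀ : 0 < t) (ht₁ : t ≤ 1) :
    x ∈ convexHull ℝ (a '' (C : Set (Fin n))) ↔
      ∃ l ∈ box (∅, C), linearCombination ℝ (lift ∘ a) l = t • lift x := by
  constructor
  · intro hx
    let X := {y | ∃ l ∈ box (∅, C), linearCombination ℝ (lift ∘ a) l = t • lift y}
    suffices hX : convexHull ℝ (a '' (C : Set (Fin n))) ⊆ X from hX hx
    refine convexHull_min (image_subset_iff.2 fun j hj => ?_) ?_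
    · refine ⟨Pi.single j t, mem_box_empty_iff.2 ⟨fun i => ?_, fun i hi => ?_⟩, ?_⟩
      · obtain rfl | hij := eq_or_ne i j
        · simpa using ⟨ht₀.le, ht₁⟩
        · simp [hij]
      · simp [(ne_of_mem_of_not_mem hj hi).symm]
      · exact Fintype.linearCombination_apply_single ..
    · rintro y ⟨l, hl, hly⟩ z ⟨m, hm, hmz⟩ p q hp hq hpq
      refine ⟨p • l + q • m, convex_Icc _ _ hl hm hp hq hpq, ?_⟩
      have hlift : lift (p • y + q • z) = p • lift y + q • lift z := by
        ext1 <;> simp [lift, hpq]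
      rw [map_add, map_smul, map_smul, hly, hmz, hlift, smul_add, smul_comm t, smul_comm t]
  · rintro ⟨l, hl, hlx⟩
    obtain ⟨hl_mem, hl_zero⟩ := mem_box_empty_iff.1 hl
    rw [linearCombination_lift, lift, Prod.smul_mk, Prod.mk_inj, smul_eq_mul, mul_one,
      ← Finset.sum_subset C.subset_univ fun i _ hi => by rw [hl_zero i hi, zero_smul],
      ← Finset.sum_subset C.subset_univ fun i _ hi => hl_zero i hi] at hlx
    have hmem := C.centerMass_mem_convexHull (fun i _ => (hl_mem i).1) (hlx.2 ▸ ht₀)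
      fun i hi => mem_image_of_mem a (Finset.mem_coe.2 hi)
    rwa [Finset.centerMass, hlx.1, hlx.2, inv_smul_smul₀ ht₀.ne'] at hmem

/-- A point is generic when it lies in the convex hull of no `d` points of the configuration. -/
def IsGeneric (a : Fin n → EuclideanSpace ℝ (Fin d)) (x : EuclideanSpace ℝ (Fin d)) : Prop :=
  ∀ C : Finset (Fin n), C.card ≤ d → x ∉ convexHull ℝ (a '' (C : Set (Fin n)))

theorem measure_convexHull_image_eq_zero {ι E : Type*} [NormedAddCommGroup E] [NormedSpace ℝ E]
    [FiniteDimensional ℝ E] [MeasurableSpace E] [BorelSpace E] (μ : MeasureTheory.Measure E)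
    [μ.IsAddHaarMeasure] (a : ι → E) {C : Finset ι} (hC : C.card ≤ Module.finrank ℝ E) :
    μ (convexHull ℝ (a '' (C : Set ι))) = 0 := by
  classical
  refine MeasureTheory.measure_mono_null (convexHull_subset_affineSpan _)
    (MeasureTheory.Measure.addHaar_affineSubspace μ _ fun htop => ?_)
  obtain hcard | hpos := C.card.eq_zero_or_pos
  · rw [Finset.card_eq_zero.1 hcard, Finset.coe_empty, image_empty,
      AffineSubspace.span_empty] at htop
    exact AffineSubspace.bot_ne_top ℝ E E htop
  · have hrank := finrank_vectorSpan_image_finset_le ℝ a C (Nat.sub_add_cancel hpos).symm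
    rw [Finset.coe_image, ← direction_affineSpan, htop, AffineSubspace.direction_top,
      finrank_top] at hrank
    omega

theorem ae_isGeneric (a : Fin n → EuclideanSpace ℝ (Fin d)) :
    ∀ᵐ x ∂(MeasureTheory.volume : MeasureTheory.Measure (EuclideanSpace ℝ (Fin d))),
      IsGeneric a x := by
  refine MeasureTheory.ae_all_iff.2 fun C => Filter.eventually_imp_distrib_left.2 fun hC => ?_
  exact MeasureTheory.measure_eq_zero_iff_ae_notMem.1
    (measure_convexHull_image_eq_zero _ a (by simpa using hC))

theorem IsGeneric.subset_of_mem_convexHull_inter {x : EuclideanSpace ℝ (Fin d)}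
    (hx : IsGeneric a x) {B C : Finset (Fin n)} (hB : B.card = d + 1)
    (hxBC : x ∈ convexHull ℝ (a '' (B ∩ C : Finset (Fin n)))) : B ⊆ C := by
  have hcard : d < (B ∩ C).card := lt_of_not_ge fun h => hx _ h hxBC
  exact Finset.inter_eq_left.1 (Finset.eq_of_subset_of_card_le Finset.inter_subset_left (by omega))

namespace IsFineZonotopalTiling

theorem isTilingSection (hP : IsFineZonotopalTiling a P) :
    IsTilingSection (lift ∘ a) Finset.univ P where
  disjoint T hT := (hP.isTileLabel T hT).disjoint
  linearIndepOn T hT := linearIndepOn_lift (hP.isTileLabel T hT).affineIndependent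
  subset _ _ := ⟨Finset.subset_univ _, Finset.subset_univ _⟩
  injOn := by
    intro l hl m hm hlm
    obtain ⟨T, hT, hl⟩ := mem_iUnion₂.1 hl
    obtain ⟨T', hT', hm⟩ := mem_iUnion₂.1 hm
    have hlab := hP.isTileLabel T hT
    have hlab' := hP.isTileLabel T' hT'
    have hmem : linearCombination ℝ (lift ∘ a) l ∈ tileSet a T ∩ tileSet a T' := by
      rw [tileSet_eq_image_box hlab.disjoint, tileSet_eq_image_box hlab'.disjoint]
      exact ⟨⟨l, hl, rfl⟩, ⟨m, hm, hlm.symm⟩⟩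
    obtain ⟨F, hF, hF', hFeq⟩ := hP.inter_face T hT T' hT' ⟨_, hmem⟩
    rw [hFeq, tileSet_eq_image_box (hF.disjoint hlab.disjoint)] at hmem
    obtain ⟨f, hf, hfl⟩ := hmem
    calc l = f := (injOn_linearCombination_box (linearIndepOn_lift hlab.affineIndependent)
          (hF.box_subset hf) hl hfl).symm
      _ = m := injOn_linearCombination_box (linearIndepOn_lift hlab'.affineIndependent)
          (hF'.box_subset hf) hm (hfl.trans hlm)
  surjOn := by
    rw [SurjOn, ← zonotope_eq_image_box, ← hP.iUnion_eq, boxUnion, image_iUnion₂]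
    exact iUnion₂_mono fun T hT => (tileSet_eq_image_box (hP.isTileLabel T hT).disjoint).subset

theorem exists_tile (hP : IsFineZonotopalTiling a P) {x : EuclideanSpace ℝ (Fin d)}
    (hx : IsGeneric a x) {S : Finset (Fin n)} (hxS : x ∈ convexHull ℝ (a '' (S : Set (Fin n)))) :
    ∃ T ∈ P, x ∈ simplex a T ∧ T.2 ⊆ S ∧ Disjoint T.1 S := by
  obtain ⟨l, hl, hlx⟩ := (hP.isTilingSection.restrict S.subset_univ).surjOn
    ((mem_convexHull_image_iff one_half_pos one_half_lt_one.le).1 hxS)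
  rw [boxUnion, biUnion_image] at hl
  obtain ⟨T, hT, hl⟩ := mem_iUnion₂.1 hl
  have hsum : ∑ i, l i = 1 / 2 := by
    simpa [linearCombination_lift, lift] using congrArg Prod.snd hlx
  have hTS : Disjoint T.1 S := by
    refine Finset.disjoint_left.2 fun i hi hiS => ?_
    have hli : l i = 1 := (mem_box_iff.1 hl).2.1 i (Finset.mem_inter.2 ⟨hi, hiS⟩)
    have hle := Finset.single_le_sum (fun j _ => (coord_mem_Icc hl j).1) (Finset.mem_univ i)
    linarith
  rw [restrictLabel, Finset.disjoint_iff_inter_eq_empty.1 hTS] at hl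
  have hxTS := (mem_convexHull_image_iff one_half_pos one_half_lt_one.le).2 ⟨l, hl, hlx⟩
  have hsub : T.2 ⊆ S := hx.subset_of_mem_convexHull_inter (hP.isTileLabel T hT).card_eq hxTS
  rw [Finset.inter_eq_left.2 hsub] at hxTS
  exact ⟨T, hT, hxTS, hsub, hTS⟩

theorem tile_unique (hP : IsFineZonotopalTiling a P) {x : EuclideanSpace ℝ (Fin d)}
    (hx : IsGeneric a x) {S : Finset (Fin n)} {T T' : Label n} (hT : T ∈ P) (hT' : T' ∈ P)
    (hxT : x ∈ simplex a T) (hxT' : x ∈ simplex a T') (hsub : T.2 ⊆ S) (hsub' : T'.2 ⊆ S)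
    (hTS : Disjoint T.1 S) (hTS' : Disjoint T'.1 S) : T = T' := by
  obtain ⟨l, hl, hlx⟩ := (mem_convexHull_image_iff one_half_pos one_half_lt_one.le).1 hxT
  obtain ⟨m, hm, hmx⟩ := (mem_convexHull_image_iff one_half_pos one_half_lt_one.le).1 hxT'
  have hlabel {T : Label n} (hT : T ∈ P) (hsub : T.2 ⊆ S) (hTS : Disjoint T.1 S) :
      (∅, T.2) ∈ restrictLabel S '' P :=
    ⟨T, hT, Prod.ext (Finset.disjoint_iff_inter_eq_empty.1 hTS) (Finset.inter_eq_left.2 hsub)⟩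
  obtain rfl : l = m := (hP.isTilingSection.restrict S.subset_univ).injOn
    (subset_boxUnion (hlabel hT hsub hTS) hl) (subset_boxUnion (hlabel hT' hsub' hTS') hm)
    (hlx.trans hmx.symm)
  rw [mem_box_empty_iff] at hl hm
  have hxTT' : x ∈ convexHull ℝ (a '' (T.2 ∩ T'.2 : Finset (Fin n))) :=
    (mem_convexHull_image_iff one_half_pos one_half_lt_one.le).2
      ⟨l, mem_box_empty_iff.2 ⟨hl.1, by grind⟩, hlx⟩
  have hsnd : T.2 = T'.2 := Finset.Subset.antisymm
    (hx.subset_of_mem_convexHull_inter (hP.isTileLabel T hT).card_eq hxTT')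
    (hx.subset_of_mem_convexHull_inter (hP.isTileLabel T' hT').card_eq
      (Finset.inter_comm T.2 T'.2 ▸ hxTT'))
  have hspan := span_lift_eq_top (hP.isTileLabel T hT)
  exact Prod.ext (hP.isTilingSection.fst_eq (hspan ▸ subset_univ _) hT (hsnd ▸ hT')) hsnd

end IsFineZonotopalTiling

end Tiling

section Counting

theorem sum_choose_mul_choose (d m b : ℕ) :
    ∑ i ∈ Finset.range (m + 1), (i + d).choose d * (m - i).choose b =
      (m + d + 1).choose (d + 1 + b) := by
  induction m generalizing b with
  | zero =>
    cases b with
    | zero => simp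
    | succ b => simp [Nat.choose_eq_zero_of_lt (show d + 1 < d + 1 + (b + 1) by omega)]
  | succ m ih =>
    cases b with
    | zero => simp [Nat.sum_range_add_choose]
    | succ b =>
      have hpascal : ∀ i ∈ Finset.range (m + 1), (i + d).choose d * (m + 1 - i).choose (b + 1) =
          (i + d).choose d * (m - i).choose b + (i + d).choose d * (m - i).choose (b + 1) := by
        intro i hi
        rw [Nat.succ_sub (Finset.mem_range_succ_iff.1 hi), Nat.choose_succ_succ, mul_add]
      rw [Finset.sum_range_succ, Finset.sum_congr rfl hpascal, Finset.sum_add_distrib, ih, ih,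
        Nat.sub_self, Nat.choose_zero_succ, mul_zero, add_zero, Nat.add_right_comm m 1 d,
        ← add_assoc (d + 1) b 1, ← Nat.choose_succ_succ' (m + d + 1)]

theorem eq_of_sum_mul_choose_eq {m k : ℕ} (hk : k ≤ m) {N N' : ℕ → ℕ}
    (h : ∀ b, m ≤ b + k → b ≤ m → ∑ i ∈ Finset.range (m + 1), N i * (m - i).choose b =
      ∑ i ∈ Finset.range (m + 1), N' i * (m - i).choose b) : N k = N' k := by
  induction k using Nat.strong_induction_on with
  | _ k ih =>
    have hother : ∑ i ∈ (Finset.range (m + 1)).erase k, N i * (m - i).choose (m - k) =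
        ∑ i ∈ (Finset.range (m + 1)).erase k, N' i * (m - i).choose (m - k) := by
      refine Finset.sum_congr rfl fun i hi => ?_
      have him : i ≤ m := Finset.mem_range_succ_iff.1 (Finset.mem_of_mem_erase hi)
      obtain hik | hki := lt_or_gt_of_ne (Finset.ne_of_mem_erase hi)
      · rw [ih i hik (hik.le.trans hk) fun b hb => h b (by omega)]
      · rw [Nat.choose_eq_zero_of_lt (by omega), mul_zero, mul_zero]
    have hk_mem : k ∈ Finset.range (m + 1) := Finset.mem_range_succ_iff.2 hk
    have hsum := h (m - k) (by omega) (Nat.sub_le m k)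
    rw [← Finset.add_sum_erase _ _ hk_mem, ← Finset.add_sum_erase _ _ hk_mem, hother] at hsum
    simpa using hsum

variable {α : Type*} [Fintype α]

theorem card_filter_powersetCard_subset_disjoint [DecidableEq α] {I B : Finset α}
    (hIB : Disjoint I B) {r : ℕ} (hr : B.card ≤ r) :
    {S ∈ (Finset.univ : Finset α).powersetCard r | B ⊆ S ∧ Disjoint I S}.card =
      (Fintype.card α - I.card - B.card).choose (r - B.card) := by
  have hfilter : {S ∈ (Finset.univ : Finset α).powersetCard r | B ⊆ S ∧ Disjoint I S} =
      {S ∈ Iᶜ.powersetCard r | B ⊆ S} := by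
    ext S
    simp only [Finset.mem_filter, Finset.mem_powersetCard, Finset.subset_univ, true_and,
      Finset.subset_compl_comm (s := S), Finset.subset_compl_iff_disjoint_right]
    tauto
  rw [hfilter, Finset.card_filter_powersetCard_subset _ _ _ _ hr, Finset.card_compl]
  exact Finset.subset_compl_iff_disjoint_left.2 hIB

theorem sum_card_fst_mul_choose {X : Finset (Finset α × Finset α)} {m c b : ℕ}
    (hdisj : ∀ T ∈ X, Disjoint T.1 T.2) (hcard : ∀ T ∈ X, T.2.card = c)
    (hα : Fintype.card α = m + c)
    (hX : ∀ S : Finset α, S.card = c + b → ∃! T, T ∈ X ∧ T.2 ⊆ S ∧ Disjoint T.1 S) :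
    ∑ i ∈ Finset.range (m + 1), {T ∈ X | T.1.card = i}.card * (m - i).choose b =
      (m + c).choose (c + b) := by
  classical
  have hle : ∀ T ∈ X, T.1.card ≤ m := fun T hT => by
    have hunion := Finset.card_le_univ (T.1 ∪ T.2)
    rw [Finset.card_union_of_disjoint (hdisj T hT), hcard T hT, hα] at hunion
    omega
  calc ∑ i ∈ Finset.range (m + 1), {T ∈ X | T.1.card = i}.card * (m - i).choose b
      = ∑ i ∈ Finset.range (m + 1), ∑ T ∈ X with T.1.card = i, (m - T.1.card).choose b :=
        Finset.sum_congr rfl fun i _ =>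
          (Finset.sum_const_nat fun T hT => by rw [(Finset.mem_filter.1 hT).2]).symm
    _ = ∑ T ∈ X, (m - T.1.card).choose b :=
        Finset.sum_fiberwise_of_maps_to
          (fun T hT => Finset.mem_range_succ_iff.2 (hle T hT)) fun T => (m - T.1.card).choose b
    _ = ∑ T ∈ X, {S ∈ (Finset.univ : Finset α).powersetCard (c + b) |
          T.2 ⊆ S ∧ Disjoint T.1 S}.card := by
        refine Finset.sum_congr rfl fun T hT => ?_
        rw [card_filter_powersetCard_subset_disjoint (hdisj T hT) (by rw [hcard T hT]; omega),
          hcard T hT, hα, Nat.sub_right_comm, Nat.add_sub_cancel, Nat.add_sub_cancel_left]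
    _ = ∑ S ∈ (Finset.univ : Finset α).powersetCard (c + b),
          {T ∈ X | T.2 ⊆ S ∧ Disjoint T.1 S}.card :=
        Finset.sum_card_bipartiteAbove_eq_sum_card_bipartiteBelow
          fun (T : Finset α × Finset α) S => T.2 ⊆ S ∧ Disjoint T.1 S
    _ = (m + c).choose (c + b) := by
        have hone : ∀ S ∈ (Finset.univ : Finset α).powersetCard (c + b),
            {T ∈ X | T.2 ⊆ S ∧ Disjoint T.1 S}.card = 1 := fun S hS => by
          simpa only [Finset.card_eq_one_iff_existsUnique, Finset.mem_filter] using
            hX S (Finset.mem_powersetCard.1 hS).2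
        rw [Finset.sum_congr rfl hone, ← Finset.card_eq_sum_ones, Finset.card_powersetCard,
          Finset.card_univ, hα]

end Counting

section Cover

variable {d n k : ℕ} {a : Fin n → EuclideanSpace ℝ (Fin d)} {P : Set (Label n)}
  {x : EuclideanSpace ℝ (Fin d)}

theorem mem_convexHull_of_mem_chk (hx : x ∈ chk a k) {S : Finset (Fin n)} (hS : n - k ≤ S.card) :
    x ∈ convexHull ℝ (a '' (S : Set (Fin n))) := by
  obtain ⟨R, hRS, hR⟩ := Finset.exists_subset_card_eq hS
  exact convexHull_mono (image_mono (Finset.coe_subset.2 hRS)) (mem_iInter₂.1 hx R hR)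

theorem IsFineZonotopalTiling.coverCount_eq (hP : IsFineZonotopalTiling a P) (hk : k + d + 1 ≤ n)
    (hx : IsGeneric a x) (hxk : x ∈ chk a k) : coverCount a P k x = (k + d).choose d := by
  classical
  obtain ⟨m, hm⟩ : ∃ m, n = m + (d + 1) := Nat.exists_eq_add_of_le' (by omega)
  let X : Finset (Label n) := {T | T ∈ P ∧ x ∈ simplex a T}
  have hX {T : Label n} : T ∈ X ↔ T ∈ P ∧ x ∈ simplex a T := by simp [X]
  have hcover : coverCount a P k x = {T ∈ X | T.1.card = k}.card := by
    rw [coverCount, ← ncard_coe_finset, Finset.coe_filter]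
    congr 1
    ext T
    simp only [orderTiles, mem_ofPred_eq, hX]
    tauto
  rw [hcover]
  refine eq_of_sum_mul_choose_eq (m := m) (N := fun i => {T ∈ X | T.1.card = i}.card)
    (N' := fun i => (i + d).choose d) (by omega) fun b hb _ => ?_
  rw [sum_choose_mul_choose]
  refine sum_card_fst_mul_choose (fun T hT => (hP.isTileLabel T (hX.1 hT).1).disjoint)
    (fun T hT => (hP.isTileLabel T (hX.1 hT).1).card_eq) (by simpa using hm) fun S hS => ?_
  obtain ⟨T, hT, hxT, hsub, hdisj⟩ :=
    hP.exists_tile hx (mem_convexHull_of_mem_chk hxk (S := S) (by omega))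
  refine ⟨T, ⟨hX.2 ⟨hT, hxT⟩, hsub, hdisj⟩, fun T' ⟨hT', hsub', hdisj'⟩ => ?_⟩
  exact hP.tile_unique hx (hX.1 hT').1 hT (hX.1 hT').2 hxT hsub' hsub hdisj' hdisj

theorem isClosed_simplex (T : Label n) : IsClosed (simplex a T) :=
  ((toFinite _).isCompact_convexHull ℝ).isClosed

theorem eventually_coverCount_le (a : Fin n → EuclideanSpace ℝ (Fin d)) (P : Set (Label n))
    (k : ℕ) (x : EuclideanSpace ℝ (Fin d)) :
    ∀ᶠ y in 𝓝 x, coverCount a P k y ≤ coverCount a P k x :=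
  (eventually_mem_imp_mem (isClosed_simplex (a := a)) x).mono fun _ hy =>
    ncard_le_ncard (fun T hT => ⟨hT.1, hy T hT.2⟩) (toFinite _)

theorem eventually_interiorCoverCount_le (a : Fin n → EuclideanSpace ℝ (Fin d))
    (P : Set (Label n)) (k : ℕ) (x : EuclideanSpace ℝ (Fin d)) :
    ∀ᶠ y in 𝓝 x, interiorCoverCount a P k x ≤ coverCount a P k y :=
  (eventually_mem_of_mem_interior (simplex a) x).mono fun _ hy =>
    ncard_le_ncard (fun T hT => ⟨hT.1, hy T hT.2⟩) (toFinite _)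

theorem interiorCoverCount_eq_coverCount (hx : ∀ T ∈ orderTiles P k, x ∉ frontier (simplex a T)) :
    interiorCoverCount a P k x = coverCount a P k x := by
  refine congrArg ncard (sep_ext_iff.2 fun T hT => ⟨fun h => interior_subset h, fun h => ?_⟩)
  by_contra hint
  exact hx T hT ⟨subset_closure h, hint⟩

theorem frequently_isGeneric_mem_chk (hint : (interior (chk a k)).Nonempty) (hx : x ∈ chk a k) :
    ∃ᶠ y in 𝓝 x, IsGeneric a y ∧ y ∈ chk a k := by
  have hconv : Convex ℝ (chk a k) := convex_iInter₂ fun _ _ => convex_convexHull ℝ _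
  have hx_closure : x ∈ closure (interior (chk a k)) := by
    rw [hconv.closure_interior_eq_closure_of_nonempty_interior hint]
    exact subset_closure hx
  have hdense : Dense {y | IsGeneric a y} := MeasureTheory.Measure.dense_of_ae (ae_isGeneric a)
  refine (mem_closure_iff_frequently.1 (closure_minimal
    (hdense.open_subset_closure_inter isOpen_interior) isClosed_closure hx_closure)).mono ?_
  exact fun y hy => ⟨hy.2, interior_subset hy.1⟩

end Cover

end ZonoTiling

end

theorem proposition4 {d n : ℕ} (a : Fin n → EuclideanSpace ℝ (Fin d))
    (ha : affineSpan ℝ (Set.range a) = ⊤)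
    (P : Set (ZonoTiling.Label n)) (hP : ZonoTiling.IsFineZonotopalTiling a P)
    (k : ℕ) (hk : k + d + 1 ≤ n) :
    (∀ᵐ x ∂(MeasureTheory.volume : MeasureTheory.Measure (EuclideanSpace ℝ (Fin d))),
      x ∈ ZonoTiling.chk a k → ZonoTiling.coverCount a P k x = (k + d).choose d) ∧
    ((interior (ZonoTiling.chk a k)).Nonempty → ∀ x ∈ ZonoTiling.chk a k,
      ZonoTiling.interiorCoverCount a P k x ≤ (k + d).choose d ∧
      (k + d).choose d ≤ ZonoTiling.coverCount a P k x ∧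
      ((∀ T ∈ ZonoTiling.orderTiles P k, x ∉ frontier (ZonoTiling.simplex a T)) →
        ZonoTiling.coverCount a P k x = (k + d).choose d)) := by
  refine ⟨(ZonoTiling.ae_isGeneric a).mono fun x hx => hP.coverCount_eq hk hx,
    fun hint x hx => ?_⟩
  obtain ⟨y, ⟨hy, hyk⟩, hyx, hxy⟩ :=
    ((ZonoTiling.frequently_isGeneric_mem_chk hint hx).and_eventually
      ((ZonoTiling.eventually_coverCount_le a P k x).and
        (ZonoTiling.eventually_interiorCoverCount_le a P k x))).exists
  rw [hP.coverCount_eq hk hy hyk] at hyx hxy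
  refine ⟨hxy, hyx, fun hfrontier => hyx.antisymm' ?_⟩
  rwa [← ZonoTiling.interiorCoverCount_eq_coverCount hfrontier]
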